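/- **Notation.** Let $n\ge 0$ and let $A\in \mathrm M_n(\mathbb Z)$ be non-singular with characteristic polynomial $h_A\in\mathbb Z[x]$. Put $$G_A=\{A^{-k}\mathbf x \mid \mathbf x\in\mathbb Z^n,\ k\in\mathbb Z\}\subseteq\mathbb Q^n,\qquad \mathcal R(A)=\mathbb Z\left[\tfrac1{\det A}\right]\subseteq\mathbb Q,$$ $$\mathcal P(A)=\{p \text{ prime} : p\mid\det A\},\qquad \mathcal P'(A)=\{p\in\mathcal P(A) : h_A\not\equiv x^n \ (\mathrm{mod}\ p)\}.$$ For a prime $p$ let $t_p(A)$ be the multiplicity of $0$ as a root of the reduction of $h_A$ modulo $p$, let $\overline G_{A,p}\subseteq\mathbb Q_p^n$ be the $\mathbb Z_p$-span of $G_A$ (that is, $G_A\otimes_{\mathbb Z}\mathbb Z_p$), and let $D_p(A)$ be the divisible part of $\overline G_{A,p}$, i.e. its largest divisible $\mathbb Z_p$-submodule. A family of $p$-adic integers $\alpha_{pij}(A)\in\mathbb Z_p$, $p\in\mathcal P'(A)$, $1\le i\le t_p(A)<j\le n$, is called the *characteristic* of $G_A$ relative to the standard basis $\mathbf e_1,\dots,\mathbf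 e_n$ of $\mathbb Z^n$ if for every $p\in\mathcal P'(A)$, with $t_p=t_p(A)$, $$\overline G_{A,p}=\mathrm{Span}_{\mathbb Q_p}(\mathbf x_{p1},\dots,\mathbf x_{pt_p})\oplus \mathrm{Span}_{\mathbb Z_p}(\mathbf e_{t_p+1},\dots,\mathbf e_n),\qquad \mathbf x_{pi}=\mathbf e_i+\sum_{j=t_p+1}^n\alpha_{pij}(A)\,\mathbf e_j .$$ Let $A,B\in\mathrm M_n(\mathbb Z)$ be non-singular, with characteristics $\alpha_{pij}(A)$ and $\alpha_{pij}(B)$ relative to the standard basis. For $p\in\mathcal P'(B)$, a matrix $T=(\gamma_{kj})\in\mathrm{GL}_n(\mathbb Q)$ *satisfies condition $(A,B,p)$* if, with $t_p=t_p(B)$, $$\gamma_{kj}-\sum_{i=1}^{t_p}\gamma_{ij}\,\alpha_{pik}(B)\in\mathbb Z_p\qquad\text{for all } k,j\in\{t_p+1,\dots,n\}.$$ Condition $(B,A,p)$, for $p\in\mathcal P'(A)$, is the same with $A$ in place of $B$. **Theorem 3.8.** Let $A,B\in\mathrm M_n(\mathbb Z)$ be non-singular and let $G_A,G_B$ have characteristics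 $\{\alpha_{pij}(A)\}$, $\{\alpha_{pij}(B)\}$ relative to the standard basis. For $T\in\mathrm{GL}_n(\mathbb Q)$ we have $T(G_A)=G_B$ if and only if all of the following hold: 1. $\mathcal P(A)=\mathcal P(B)$, $\mathcal P'(A)=\mathcal P'(B)$, $\mathcal R(A)=\mathcal R(B)$, and $t_p(A)=t_p(B)$ for every $p\in\mathcal P(A)$; 2. $T\in\mathrm{GL}_n(\mathcal R)$, where $\mathcal R=\mathcal R(A)$; 3. for every $p\in\mathcal P'(A)$: $T(D_p(A))=D_p(B)$, $T$ satisfies condition $(A,B,p)$, and $T^{-1}$ satisfies condition $(B,A,p)$. -/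

import Mathlib

open scoped BigOperators

noncomputable section

namespace Solenoid

variable {n : ℕ}

/-- The group `G_A = {A^{-k} x | x ∈ ℤ^n, k ∈ ℤ}`, as a subset of `ℚ^n`. -/
def G (A : Matrix (Fin n) (Fin n) ℤ) : Set (Fin n → ℚ) :=
  {v | ∃ (k : ℤ) (x : Fin n → ℤ),
    v = ((A.map (Int.cast : ℤ → ℚ)) ^ (-k)).mulVec (fun i => (x i : ℚ))}

/-- The set `𝒫(A)` of prime divisors of `det A`. -/
def primeDivisors (A : Matrix (Fin n) (Fin n) ℤ) : Set ℕ :=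
  {p | p.Prime ∧ (p : ℤ) ∣ A.det}

/-- The reduction modulo `p` of the characteristic polynomial of `A`. -/
def charpolyMod (p : ℕ) (A : Matrix (Fin n) (Fin n) ℤ) : Polynomial (ZMod p) :=
  A.charpoly.map (Int.castRingHom (ZMod p))

/-- The set `𝒫'(A)` of those `p ∈ 𝒫(A)` for which the characteristic polynomial of `A` is not
congruent to `x^n` modulo `p`. -/
def primeDivisors' (A : Matrix (Fin n) (Fin n) ℤ) : Set ℕ :=
  {p | p ∈ primeDivisors A ∧ charpolyMod p A ≠ Polynomial.X ^ n}

/-- The multiplicity `t_p(A)` of zero as a root of the characteristic polynomial of `A`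
modulo `p`. -/
def t (p : ℕ) (A : Matrix (Fin n) (Fin n) ℤ) : ℕ :=
  (charpolyMod p A).rootMultiplicity 0

/-- The ring `ℛ(A) = ℤ[1 / det A]`, inside `ℚ`. -/
def R (A : Matrix (Fin n) (Fin n) ℤ) : Subalgebra ℤ ℚ :=
  Algebra.adjoin ℤ {(1 : ℚ) / (A.det : ℚ)}

/-- The `ℤ_p`-module `G_A ⊗ ℤ_p`, realized in `ℚ_p^n` as the `ℤ_p`-span of `G_A`. -/
def Gbar (p : ℕ) [Fact p.Prime] (A : Matrix (Fin n) (Fin n) ℤ) :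
    Submodule ℤ_[p] (Fin n → ℚ_[p]) :=
  Submodule.span ℤ_[p] ((fun (v : Fin n → ℚ) (i : Fin n) => (v i : ℚ_[p])) '' G A)

/-- A submodule is divisible if every element is divisible in it by every non-zero scalar. -/
def IsDivisible {S M : Type*} [CommRing S] [AddCommGroup M] [Module S M]
    (D : Submodule S M) : Prop :=
  ∀ a : S, a ≠ 0 → ∀ x ∈ D, ∃ y ∈ D, a • y = x

/-- The divisible part of a submodule `N`: the submodule generated by all divisible submodules
of `N` (the largest one, sums of divisible submodules being divisible). -/
def divisiblePart {S M : Type*} [CommRing S] [AddCommGroup M] [Module S M]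
    (N : Submodule S M) : Submodule S M :=
  sSup {D | D ≤ N ∧ IsDivisible D}

/-- The divisible part `D_p(A)` of `G_A ⊗ ℤ_p`. -/
def D (p : ℕ) [Fact p.Prime] (A : Matrix (Fin n) (Fin n) ℤ) :
    Submodule ℤ_[p] (Fin n → ℚ_[p]) :=
  divisiblePart (Gbar p A)

/-- The vector of `ℚ_p^n` with the coordinates of the integer vector `v`. -/
def toPadicVec (p : ℕ) [Fact p.Prime] (v : Fin n → ℤ) : Fin n → ℚ_[p] :=
  fun i => (v i : ℚ_[p])

/-- The vector `x_i = f_i + ∑_{j > t} a_{ij} f_j`, where the `j`-th basis vector in one-based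
numbering has the index `j - 1 : Fin n`, so that `j > t` reads `t ≤ (j : ℕ)`. -/
def xvec (p : ℕ) [Fact p.Prime] (t : ℕ) (f : Module.Basis (Fin n) ℤ (Fin n → ℤ))
    (a : Fin n → Fin n → ℤ_[p]) (i : Fin n) : Fin n → ℚ_[p] :=
  toPadicVec p (f i) +
    ∑ j ∈ (Finset.univ : Finset (Fin n)).filter (fun j : Fin n => t ≤ (j : ℕ)),
      (a i j : ℚ_[p]) • toPadicVec p (f j)

/-- The `p`-adic integers `α_{pij}` (`p ∈ 𝒫'(A)`, `1 ≤ i ≤ t_p(A) < j ≤ n`) form the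
characteristic of `G_A` relative to the ordered basis `f` of `ℤ^n`: for every `p ∈ 𝒫'(A)`,
`G_A ⊗ ℤ_p = Span_{ℚ_p}(x_{p1}, …, x_{pt_p}) ⊕ Span_{ℤ_p}(f_{t_p+1}, …, f_n)` with
`x_{pi} = f_i + ∑_{j > t_p} α_{pij} f_j`. The sum is always direct, because the vectors
`x_{pi}` (`i ≤ t_p`) and `f_j` (`j > t_p`) form a basis of `ℚ_p^n`. Values of `α` at other
triples `(p, i, j)` are irrelevant. -/
def IsCharacteristic (A : Matrix (Fin n) (Fin n) ℤ) (f : Module.Basis (Fin n) ℤ (Fin n → ℤ))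
    (α : (p : ℕ) → [Fact p.Prime] → Fin n → Fin n → ℤ_[p]) : Prop :=
  ∀ (p : ℕ) [Fact p.Prime], p ∈ primeDivisors' A →
    Gbar p A =
      (Submodule.span ℚ_[p]
        (xvec p (t p A) f (α p) '' {i | (i : ℕ) < t p A})).restrictScalars ℤ_[p] ⊔
      Submodule.span ℤ_[p] ((fun j => toPadicVec p (f j)) '' {j | t p A ≤ (j : ℕ)})

/-- The condition `(A, B, p)` on a rational matrix `T = (γ_{kj})`, where `b i k = α_{pik}(B)`:
`γ_{kj} - ∑_{i ≤ t_p} γ_{ij} α_{pik}(B) ∈ ℤ_p` for all `k, j ∈ {t_p + 1, …, n}`,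
with `t_p = t_p(B)`. It does not involve the matrix `A`. -/
def Condition (B : Matrix (Fin n) (Fin n) ℤ) (p : ℕ) [Fact p.Prime]
    (b : Fin n → Fin n → ℤ_[p]) (T : Matrix (Fin n) (Fin n) ℚ) : Prop :=
  ∀ k j : Fin n, t p B ≤ (k : ℕ) → t p B ≤ (j : ℕ) →
    (T k j : ℚ_[p]) -
      ∑ i ∈ (Finset.univ : Finset (Fin n)).filter (fun i : Fin n => (i : ℕ) < t p B),
        (T i j : ℚ_[p]) * (b i k : ℚ_[p])
      ∈ PadicInt.subring p

end Solenoid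

end

noncomputable section

namespace Solenoid

variable {n : ℕ}

/-! The group `G A` is the increasing union of the lattices `A^{-k} ℤ^n`, and `Gbar p A` is that of
the `A^{-k} ℤ_p^n`. A rational vector lies in `G A` exactly when it lies in every `Gbar p A`
(`mem_G_iff_forall_mem_Gbar`), so `T (G A) = G B` can be tested one prime at a time
(`image_G_eq_iff`).

At each prime, `Gbar p A` is a `ℚ_p`-space of dimension `t p A` plus a free `ℤ_p`-module on the
remaining basis vectors (`Gbar_eq_normalForm`): it is `ℤ_p^n` if `t p A = 0`, all of `ℚ_p^n` if `t p
A = n`, and is described by the characteristic in between. The `ℚ_p`-space is the divisible part,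
hence is preserved with its dimension; modulo it, only the images of the vectors `e_j`, `j > t_p`,
need be integral, which is the condition `(A, B, p)` (`image_Gbar_eq_iff`).

Splitting this criterion by the value of `t_p` gives the theorem: for `t_p = 0` it says that `T` and
`T⁻¹` are `p`-integral, which over all such `p` means `T ∈ GL_n(ℛ)`; for `t_p = n` it is empty; the
other primes form `𝒫'`. -/

/-! ### Change of scalars and the lattice `ℤ_p^n`. -/

/-- The coordinatewise embedding of `ℚ^n` into `ℚ_p^n`. -/
abbrev castVec (p : ℕ) [Fact p.Prime] (v : Fin n → ℚ) : Fin n → ℚ_[p] :=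
  fun i => (v i : ℚ_[p])

/-- The matrix `A` over the rationals. -/
abbrev ratMat (A : Matrix (Fin n) (Fin n) ℤ) : Matrix (Fin n) (Fin n) ℚ :=
  A.map (Int.cast : ℤ → ℚ)

/-- The matrix `A` over the `p`-adic numbers. -/
abbrev padicMat (p : ℕ) [Fact p.Prime] (A : Matrix (Fin n) (Fin n) ℤ) :
    Matrix (Fin n) (Fin n) ℚ_[p] :=
  A.map (Int.cast : ℤ → ℚ_[p])

/-- The lattice `ℤ_p^n` in `ℚ_p^n`. -/
def integralVec (n p : ℕ) [Fact p.Prime] : Submodule ℤ_[p] (Fin n → ℚ_[p]) where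
  carrier := {v | ∀ i, v i ∈ PadicInt.subring p}
  zero_mem' _ := (PadicInt.subring p).zero_mem
  add_mem' hv hw i := (PadicInt.subring p).add_mem (hv i) (hw i)
  smul_mem' a _ hv i := (PadicInt.subring p).mul_mem a.2 (hv i)

theorem mem_integralVec {p : ℕ} [Fact p.Prime] {v : Fin n → ℚ_[p]} :
    v ∈ integralVec n p ↔ ∀ i, v i ∈ PadicInt.subring p := Iff.rfl

theorem isUnit_det_ratMat {A : Matrix (Fin n) (Fin n) ℤ} (hA : A.det ≠ 0) :
    IsUnit (ratMat A).det := by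
  have : (ratMat A).det = (A.det : ℚ) := ((Int.castRingHom ℚ).map_det A).symm
  rw [this]
  exact (Int.cast_ne_zero.mpr hA).isUnit

theorem castVec_mulVec (p : ℕ) [Fact p.Prime] (M : Matrix (Fin n) (Fin n) ℚ) (v : Fin n → ℚ) :
    castVec p (M.mulVec v) = (M.map (Rat.cast : ℚ → ℚ_[p])).mulVec (castVec p v) := by
  ext i
  exact (Rat.castHom ℚ_[p]).map_mulVec M v i

theorem ratMat_map (p : ℕ) [Fact p.Prime] (A : Matrix (Fin n) (Fin n) ℤ) :
    (ratMat A).map (Rat.cast : ℚ → ℚ_[p]) = padicMat p A := by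
  ext i j
  simp

theorem ratMat_pow_map (p : ℕ) [Fact p.Prime] (A : Matrix (Fin n) (Fin n) ℤ) (k : ℕ) :
    (ratMat A ^ k).map (Rat.cast : ℚ → ℚ_[p]) = padicMat p A ^ k := by
  rw [← ratMat_map]
  exact map_pow (Rat.castHom ℚ_[p]).mapMatrix (ratMat A) k

theorem padicMat_pow (p : ℕ) [Fact p.Prime] (A : Matrix (Fin n) (Fin n) ℤ) (k : ℕ) :
    padicMat p A ^ k = padicMat p (A ^ k) :=
  (map_pow (Int.castRingHom ℚ_[p]).mapMatrix A k).symm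

theorem padicMat_mulVec_mem {p : ℕ} [Fact p.Prime] (A : Matrix (Fin n) (Fin n) ℤ)
    {v : Fin n → ℚ_[p]} (hv : v ∈ integralVec n p) :
    (padicMat p A).mulVec v ∈ integralVec n p := fun i =>
  (PadicInt.subring p).sum_mem (t := Finset.univ) (f := fun j => ((A i j : ℤ) : ℚ_[p]) * v j)
    fun j _ => (PadicInt.subring p).mul_mem (intCast_mem (PadicInt.subring p) _) (hv j)

theorem padicMat_pow_mulVec_mem_of_le {p : ℕ} [Fact p.Prime] {A : Matrix (Fin n) (Fin n) ℤ}
    {v : Fin n → ℚ_[p]} {k l : ℕ} (hkl : k ≤ l)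
    (hv : (padicMat p A ^ k).mulVec v ∈ integralVec n p) :
    (padicMat p A ^ l).mulVec v ∈ integralVec n p := by
  obtain ⟨m, rfl⟩ := Nat.exists_eq_add_of_le' hkl
  rw [pow_add, ← Matrix.mulVec_mulVec, padicMat_pow p A m]
  exact padicMat_mulVec_mem _ hv

/-! ### Membership in `G A` and `Gbar p A`, and the local-global principle. -/

/-- Positive powers of `A` preserve `ℤ^n`, so only the vectors `A^{-k} x` with `k ≥ 0` matter. -/
theorem mem_G_iff {A : Matrix (Fin n) (Fin n) ℤ} (hA : A.det ≠ 0) {v : Fin n → ℚ} :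
    v ∈ G A ↔ ∃ (k : ℕ) (x : Fin n → ℤ), (ratMat A ^ k).mulVec v = fun i => (x i : ℚ) := by
  have hu := isUnit_det_ratMat hA
  constructor
  · rintro ⟨k, x, rfl⟩
    obtain ⟨m, rfl | rfl⟩ := k.eq_nat_or_neg
    · refine ⟨m, x, ?_⟩
      rw [Matrix.mulVec_mulVec, ← zpow_natCast, ← Matrix.zpow_add hu]
      simp
    · refine ⟨0, (A ^ m).mulVec x, ?_⟩
      have h : ratMat A ^ m = ratMat (A ^ m) :=
        (map_pow (Int.castRingHom ℚ).mapMatrix A m).symm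
      rw [pow_zero, Matrix.one_mulVec, neg_neg, zpow_natCast]
      change (ratMat A ^ m).mulVec _ = _
      rw [h]
      ext i
      exact ((Int.castRingHom ℚ).map_mulVec (A ^ m) x i).symm
  · rintro ⟨k, x, h⟩
    refine ⟨k, x, ?_⟩
    rw [← h, Matrix.mulVec_mulVec, ← zpow_natCast, ← Matrix.zpow_add hu]
    simp

/-- The sets `A^{-k} ℤ_p^n` increase with `k`, so their union is a submodule, and it contains `G A`.
Conversely `A^{-k} y` is a `ℤ_p`-combination of the columns of `A^{-k}`, which belong to `G A`. -/
theorem mem_Gbar_iff {p : ℕ} [Fact p.Prime] {A : Matrix (Fin n) (Fin n) ℤ} (hA : A.det ≠ 0)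
    {v : Fin n → ℚ_[p]} :
    v ∈ Gbar p A ↔ ∃ k : ℕ, (padicMat p A ^ k).mulVec v ∈ integralVec n p := by
  have hu := isUnit_det_ratMat hA
  constructor
  · intro hv
    induction hv using Submodule.span_induction with
    | mem v hv =>
      obtain ⟨w, hw, rfl⟩ := hv
      obtain ⟨k, x, h⟩ := (mem_G_iff hA).1 hw
      refine ⟨k, fun i => ?_⟩
      have h' := congrFun (castVec_mulVec p (ratMat A ^ k) w) i
      rw [ratMat_pow_map, h] at h'
      rw [← h']
      simp
    | zero => exact ⟨0, by simp⟩
    | add v w _ _ hv hw =>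
      obtain ⟨k, hk⟩ := hv
      obtain ⟨l, hl⟩ := hw
      refine ⟨max k l, ?_⟩
      rw [Matrix.mulVec_add]
      exact Submodule.add_mem _ (padicMat_pow_mulVec_mem_of_le (le_max_left k l) hk)
        (padicMat_pow_mulVec_mem_of_le (le_max_right k l) hl)
    | smul a v _ hv =>
      obtain ⟨k, hk⟩ := hv
      refine ⟨k, ?_⟩
      rw [Matrix.mulVec_smul]
      exact Submodule.smul_mem _ _ hk
  · rintro ⟨k, hk⟩
    set y := (padicMat p A ^ k).mulVec v with hy
    set C : Matrix (Fin n) (Fin n) ℚ := (ratMat A ^ k)⁻¹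
    have hC : C * ratMat A ^ k = 1 :=
      Matrix.nonsing_inv_mul _ (by rw [Matrix.det_pow]; exact hu.pow k)
    have hC' : C.map (Rat.cast : ℚ → ℚ_[p]) * padicMat p A ^ k = 1 := by
      rw [← ratMat_pow_map]
      have := congrArg (Rat.castHom ℚ_[p]).mapMatrix hC
      rwa [map_mul, map_one] at this
    let z : Fin n → ℤ_[p] := fun j => ⟨y j, hk j⟩
    have hv : v = ∑ j, (z j • castVec p (fun i => C i j) : Fin n → ℚ_[p]) := by
      have : v = (C.map (Rat.cast : ℚ → ℚ_[p])).mulVec y := by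
        rw [hy, Matrix.mulVec_mulVec, hC', Matrix.one_mulVec]
      ext i
      rw [this, Finset.sum_apply, Matrix.mulVec, dotProduct]
      exact Finset.sum_congr rfl fun j _ => mul_comm (C i j : ℚ_[p]) (y j)
    rw [hv]
    refine Submodule.sum_mem _ fun j _ => Submodule.smul_mem _ _ (Submodule.subset_span ⟨_, ?_, rfl⟩)
    refine (mem_G_iff hA).2 ⟨k, Pi.single j 1, ?_⟩
    have hC2 : ratMat A ^ k * C = 1 :=
      Matrix.mul_nonsing_inv _ (by rw [Matrix.det_pow]; exact hu.pow k)
    ext i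
    have := congrFun (congrFun hC2 i) j
    rw [Matrix.one_apply] at this
    refine this.trans ?_
    simp [Pi.single_apply]

theorem integralVec_le_Gbar {p : ℕ} [Fact p.Prime] {A : Matrix (Fin n) (Fin n) ℤ}
    (hA : A.det ≠ 0) : integralVec n p ≤ Gbar p A := fun v hv =>
  (mem_Gbar_iff hA).2 ⟨0, by simpa using hv⟩

theorem rat_mem_subring_iff {p : ℕ} [Fact p.Prime] {q : ℚ} :
    (q : ℚ_[p]) ∈ PadicInt.subring p ↔ ¬ p ∣ q.den := by
  refine ⟨fun h hpd => ?_, Padic.norm_rat_le_one⟩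
  have h1 := PadicInt.isUnit_iff.1 (PadicInt.isUnit_den q h)
  rw [PadicInt.norm_natCast_eq_one_iff] at h1
  exact (Fact.out : p.Prime).coprime_iff_not_dvd.1 h1 hpd

theorem rat_integral_of_forall_prime {q : ℚ}
    (hq : ∀ (p : ℕ) [Fact p.Prime], (q : ℚ_[p]) ∈ PadicInt.subring p) : ∃ m : ℤ, q = m := by
  have : q.den = 1 := by
    by_contra h
    obtain ⟨p, hp, hpd⟩ := Nat.exists_prime_and_dvd h
    have := Fact.mk hp
    exact rat_mem_subring_iff.1 (hq p) hpd
  exact ⟨q.num, (Rat.coe_int_num_of_den_eq_one this).symm⟩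

/-- The exponent `k` may depend on `p`, but only the finitely many primes in the denominators of `v`
need a positive one. The largest of these makes `A^K v` integral at every prime, hence integral. -/
theorem mem_G_iff_forall_mem_Gbar {A : Matrix (Fin n) (Fin n) ℤ} (hA : A.det ≠ 0)
    {v : Fin n → ℚ} :
    v ∈ G A ↔ ∀ (p : ℕ) [Fact p.Prime], castVec p v ∈ Gbar p A := by
  refine ⟨fun hv p _ => Submodule.subset_span ⟨v, hv, rfl⟩, fun hv => ?_⟩
  have hex : ∀ p : ℕ, ∃ k : ℕ, ∀ [Fact p.Prime],
      (padicMat p A ^ k).mulVec (castVec p v) ∈ integralVec n p := by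
    intro p
    by_cases hp : p.Prime
    · have := Fact.mk hp
      obtain ⟨k, hk⟩ := (mem_Gbar_iff hA).1 (hv p)
      exact ⟨k, fun {_} => hk⟩
    · exact ⟨0, fun {h} => (hp h.out).elim⟩
  choose k hk using hex
  set d := ∏ i, (v i).den with hd
  have hd0 : d ≠ 0 := Finset.prod_ne_zero_iff.2 fun i _ => (v i).den_nz
  set K := d.primeFactors.sup k
  have hK : ∀ (p : ℕ) [Fact p.Prime],
      (padicMat p A ^ K).mulVec (castVec p v) ∈ integralVec n p := by
    intro p hp
    by_cases hpd : p ∣ d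
    · exact padicMat_pow_mulVec_mem_of_le
        (Finset.le_sup (Nat.mem_primeFactors.2 ⟨hp.out, hpd, hd0⟩)) (hk p)
    · refine padicMat_pow_mulVec_mem_of_le (Nat.zero_le K) ?_
      rw [pow_zero, Matrix.one_mulVec]
      exact fun i => Padic.norm_rat_le_one fun h =>
        hpd (h.trans (Finset.dvd_prod_of_mem _ (Finset.mem_univ i)))
  have hint : ∀ i, ∃ m : ℤ, (ratMat A ^ K).mulVec v i = m := by
    intro i
    refine rat_integral_of_forall_prime fun p hp => ?_
    have := hK p i
    rw [← ratMat_pow_map, ← castVec_mulVec] at this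
    exact this
  choose x hx using hint
  exact (mem_G_iff hA).2 ⟨K, x, funext hx⟩

/-- Taking `ℤ_p`-spans commutes with `M`, which gives one direction; the other is the local-global
principle applied to `v` and to `M v`. -/
theorem image_G_eq_iff {A B : Matrix (Fin n) (Fin n) ℤ} (hA : A.det ≠ 0) (hB : B.det ≠ 0)
    {M N : Matrix (Fin n) (Fin n) ℚ} (hMN : M * N = 1) (hNM : N * M = 1) :
    (fun v => M.mulVec v) '' G A = G B ↔
      ∀ (p : ℕ) [Fact p.Prime],
        (fun v => (M.map (Rat.cast : ℚ → ℚ_[p])).mulVec v) '' (Gbar p A : Set (Fin n → ℚ_[p])) =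
          Gbar p B := by
  constructor
  · intro h p _
    have := Submodule.map_span ((M.map (Rat.cast : ℚ → ℚ_[p])).mulVecLin.restrictScalars ℤ_[p])
      (castVec p '' G A)
    refine (congrArg (fun S : Submodule ℤ_[p] (Fin n → ℚ_[p]) => (S : Set (Fin n → ℚ_[p])))
      this).trans ?_
    change _ = ((Submodule.span ℤ_[p] (castVec p '' G B) : Submodule _ _) : Set (Fin n → ℚ_[p]))
    rw [← h, Set.image_image, Set.image_image]
    congr! 3 with v
    exact (castVec_mulVec p M v).symm
  · intro h
    have key : ∀ v, v ∈ G A ↔ M.mulVec v ∈ G B := by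
      intro v
      rw [mem_G_iff_forall_mem_Gbar hA, mem_G_iff_forall_mem_Gbar hB]
      refine forall_congr' fun p => forall_congr' fun hp => ?_
      have hinj : Function.Injective fun v => (M.map (Rat.cast : ℚ → ℚ_[p])).mulVec v := by
        refine Matrix.mulVec_injective_of_isUnit
          (IsUnit.map (Rat.castHom ℚ_[p]).mapMatrix ⟨⟨M, N, hMN, hNM⟩, rfl⟩)
      rw [castVec_mulVec, ← SetLike.mem_coe, ← SetLike.mem_coe, ← h p]
      exact (hinj.mem_set_image).symm
    ext w
    constructor
    · rintro ⟨v, hv, rfl⟩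
      exact (key v).1 hv
    · intro hw
      have hMNw : M.mulVec (N.mulVec w) = w := by
        rw [Matrix.mulVec_mulVec, hMN, Matrix.one_mulVec]
      exact ⟨N.mulVec w, (key _).2 (by rwa [hMNw]), hMNw⟩

/-! ### The divisible part and the ring `R A`, described locally. -/

/-- As `ℚ_p^n` is torsion-free, divisible `ℤ_p`-submodules are the same as `ℚ_p`-subspaces; the
vectors whose whole `ℚ_p`-line stays in `Gbar p A` form the largest one. -/
theorem mem_D_iff {p : ℕ} [Fact p.Prime] {A : Matrix (Fin n) (Fin n) ℤ} {v : Fin n → ℚ_[p]} :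
    v ∈ D p A ↔ ∀ c : ℚ_[p], c • v ∈ Gbar p A := by
  let E : Submodule ℤ_[p] (Fin n → ℚ_[p]) :=
    { carrier := {v | ∀ c : ℚ_[p], c • v ∈ Gbar p A}
      zero_mem' := fun c => by simp
      add_mem' := fun hv hw c => by
        rw [smul_add]
        exact Submodule.add_mem _ (hv c) (hw c)
      smul_mem' := fun a v hv c => by
        rw [smul_comm]
        exact Submodule.smul_mem _ _ (hv c) }
  suffices h : D p A = E by
    rw [h]
    rfl
  apply le_antisymm
  · refine sSup_le fun D' hD' v hv c => ?_
    obtain ⟨a, b, hb, rfl⟩ := IsFractionRing.div_surjective (A := ℤ_[p]) c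
    obtain ⟨y, hy, rfl⟩ := hD'.2 b (nonZeroDivisors.ne_zero hb) v hv
    have hb' : algebraMap ℤ_[p] ℚ_[p] b ≠ 0 := by
      simpa using nonZeroDivisors.ne_zero hb
    rw [← algebraMap_smul ℚ_[p] b y, smul_smul, div_mul_cancel₀ _ hb', algebraMap_smul]
    exact hD'.1 (Submodule.smul_mem _ _ hy)
  · refine le_sSup ⟨fun v hv => by simpa using hv 1, fun a ha v hv => ?_⟩
    have ha' : algebraMap ℤ_[p] ℚ_[p] a ≠ 0 := by simpa using ha
    refine ⟨(algebraMap ℤ_[p] ℚ_[p] a)⁻¹ • v, fun c => ?_, ?_⟩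
    · rw [smul_smul]
      exact hv _
    · rw [← algebraMap_smul ℚ_[p] a, smul_smul, mul_inv_cancel₀ ha', one_smul]

theorem mem_R_iff {A : Matrix (Fin n) (Fin n) ℤ} (hA : A.det ≠ 0) {q : ℚ} :
    q ∈ R A ↔ ∀ (p : ℕ) [Fact p.Prime], ¬ (p : ℤ) ∣ A.det → (q : ℚ_[p]) ∈ PadicInt.subring p := by
  constructor
  · intro hq p _ hp
    induction hq using Algebra.adjoin_induction with
    | mem x hx =>
      rw [Set.mem_singleton_iff] at hx
      subst hx
      have h1 : ‖(A.det : ℚ_[p])‖ = 1 :=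
        le_antisymm (Padic.norm_int_le_one _)
          (not_lt.1 fun h => hp (Padic.norm_intCast_lt_one_iff.1 h))
      rw [PadicInt.mem_subring_iff, one_div, Rat.cast_inv, Rat.cast_intCast, norm_inv, h1, inv_one]
    | algebraMap r => simp
    | add x y _ _ hx hy =>
      rw [Rat.cast_add]
      exact (PadicInt.subring p).add_mem hx hy
    | mul x y _ _ hx hy =>
      rw [Rat.cast_mul]
      exact (PadicInt.subring p).mul_mem hx hy
  · intro h
    have hsub : q.den.primeFactors ⊆ A.det.natAbs.primeFactors := by
      intro p hp
      rw [Nat.mem_primeFactors] at hp ⊢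
      refine ⟨hp.1, ?_, Int.natAbs_ne_zero.2 hA⟩
      have := Fact.mk hp.1
      by_contra hpd
      exact rat_mem_subring_iff.1 (h p fun h' => hpd (Int.natCast_dvd.1 h')) hp.2.1
    -- The exponent is a crude bound: no prime occurs in `q.den` more than `q.den` times, so `q.den`
    -- divides that power of its radical, and the radical divides `det A`.
    have hdvd : (q.den : ℤ) ∣ A.det ^ q.den := by
      rw [Int.natCast_dvd, Int.natAbs_pow]
      exact (Nat.dvd_prod_primeFactors_pow_self q.den_nz).trans (pow_dvd_pow_of_dvd
        ((Finset.prod_dvd_prod_of_subset _ _ _ hsub).trans (Nat.prod_primeFactors_dvd _)) _)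
    obtain ⟨c, hc⟩ := hdvd
    have hq : q = ((q.num * c : ℤ) : ℚ) * (1 / (A.det : ℚ)) ^ q.den := by
      have hc' : (A.det : ℚ) ^ q.den = q.den * c := by exact_mod_cast hc
      have hA' : (A.det : ℚ) ≠ 0 := Int.cast_ne_zero.2 hA
      have hden : (q.den : ℚ) ≠ 0 := Nat.cast_ne_zero.2 q.den_nz
      have hc0 : (c : ℚ) ≠ 0 := by
        rintro h0
        rw [h0, mul_zero] at hc'
        exact pow_ne_zero _ hA' hc'
      rw [one_div, inv_pow, hc']
      nth_rewrite 1 [← Rat.num_div_den q]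
      push_cast
      field_simp
    rw [hq]
    exact (R A).mul_mem (intCast_mem (R A) _)
      ((R A).pow_mem (Algebra.subset_adjoin (Set.mem_singleton _)) _)

/-! ### The multiplicity `t p A` and its extreme values `0` and `n`. -/

theorem t_le (p : ℕ) [Fact p.Prime] (A : Matrix (Fin n) (Fin n) ℤ) : t p A ≤ n := by
  have hm : (charpolyMod p A).Monic := A.charpoly_monic.map _
  have hdeg : (charpolyMod p A).natDegree = n := by
    rw [charpolyMod, A.charpoly_monic.natDegree_map, A.charpoly_natDegree_eq_dim, Fintype.card_fin]
  exact hdeg.le.trans' <| (Polynomial.count_roots _).symm.le.trans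
    ((Multiset.count_le_card _ _).trans (Polynomial.card_roots' _))

/-- The constant coefficient of the characteristic polynomial is `± det A`. -/
theorem t_eq_zero_iff {p : ℕ} [Fact p.Prime] {A : Matrix (Fin n) (Fin n) ℤ} :
    t p A = 0 ↔ ¬ (p : ℤ) ∣ A.det := by
  have hm : (charpolyMod p A).Monic := A.charpoly_monic.map _
  rw [← Nat.pos_iff_ne_zero.not_left, t, Polynomial.rootMultiplicity_pos hm.ne_zero,
    Polynomial.IsRoot, ← Polynomial.coeff_zero_eq_eval_zero, charpolyMod, Polynomial.coeff_map,
    eq_intCast, ZMod.intCast_zmod_eq_zero_iff_dvd, A.det_eq_sign_charpoly_coeff]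
  rw [((IsUnit.neg isUnit_one).pow _).dvd_mul_left]

theorem t_eq_iff {p : ℕ} [Fact p.Prime] {A : Matrix (Fin n) (Fin n) ℤ} :
    t p A = n ↔ charpolyMod p A = Polynomial.X ^ n := by
  have hm : (charpolyMod p A).Monic := A.charpoly_monic.map _
  have hdeg : (charpolyMod p A).natDegree = n := by
    rw [charpolyMod, A.charpoly_monic.natDegree_map, A.charpoly_natDegree_eq_dim, Fintype.card_fin]
  constructor
  · intro h
    have hd := Polynomial.pow_rootMultiplicity_dvd (charpolyMod p A) 0
    change _ ^ (t p A) ∣ _ at hd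
    rw [h, Polynomial.C_0, sub_zero] at hd
    exact (Polynomial.eq_of_monic_of_dvd_of_natDegree_le (Polynomial.monic_X_pow n) hm hd
      (by rw [hdeg, Polynomial.natDegree_X_pow]))
  · intro h
    rw [t, h]
    have := Polynomial.rootMultiplicity_X_sub_C_pow (0 : ZMod p) n
    simpa using this

theorem mem_primeDivisors_iff {p : ℕ} [hp : Fact p.Prime] {A : Matrix (Fin n) (Fin n) ℤ} :
    p ∈ primeDivisors A ↔ t p A ≠ 0 := by
  rw [Ne, t_eq_zero_iff, not_not]
  exact and_iff_right hp.out

theorem mem_primeDivisors'_iff {p : ℕ} [Fact p.Prime] {A : Matrix (Fin n) (Fin n) ℤ} :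
    p ∈ primeDivisors' A ↔ t p A ≠ 0 ∧ t p A ≠ n :=
  and_congr mem_primeDivisors_iff t_eq_iff.symm.not

/-- Here `det A` is a `p`-adic unit, so multiplying by the adjugate of `A ^ k` recovers integrality
of `v` from that of `A ^ k v`. -/
theorem Gbar_eq_integralVec {p : ℕ} [Fact p.Prime] {A : Matrix (Fin n) (Fin n) ℤ}
    (hA : A.det ≠ 0) (ht : t p A = 0) : Gbar p A = integralVec n p := by
  refine le_antisymm (fun v hv => ?_) (integralVec_le_Gbar hA)
  obtain ⟨k, hk⟩ := (mem_Gbar_iff hA).1 hv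
  have h1 : ‖(((A ^ k).det : ℤ) : ℚ_[p])‖ = 1 := by
    rw [Matrix.det_pow, Int.cast_pow, norm_pow]
    have : ‖(A.det : ℚ_[p])‖ = 1 := le_antisymm (Padic.norm_int_le_one _)
      (not_lt.1 fun h => t_eq_zero_iff.1 ht (Padic.norm_intCast_lt_one_iff.1 h))
    rw [this, one_pow]
  have h2 : (padicMat p (A ^ k).adjugate).mulVec ((padicMat p A ^ k).mulVec v) =
      (((A ^ k).det : ℤ) : ℚ_[p]) • v := by
    rw [padicMat_pow, Matrix.mulVec_mulVec]
    have := congrArg (Int.castRingHom ℚ_[p]).mapMatrix (Matrix.adjugate_mul (A ^ k))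
    rw [map_mul] at this
    refine (congrArg (fun M => Matrix.mulVec M v) this).trans ?_
    rw [zsmul_eq_mul, map_mul, map_one, mul_one, map_intCast, ← zsmul_one, Matrix.smul_mulVec,
      Matrix.one_mulVec, Int.cast_smul_eq_zsmul]
  intro i
  have h3 := padicMat_mulVec_mem (A ^ k).adjugate hk i
  rw [h2, Pi.smul_apply, smul_eq_mul, PadicInt.mem_subring_iff, norm_mul, h1, one_mul] at h3
  exact h3

/-- Write the characteristic polynomial as `X^n + p g`; Cayley-Hamilton gives `A ^ n = -p g(A)`. -/
theorem exists_pow_eq_smul {p : ℕ} [Fact p.Prime] {A : Matrix (Fin n) (Fin n) ℤ}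
    (ht : t p A = n) : ∃ M : Matrix (Fin n) (Fin n) ℤ, A ^ n = (p : ℤ) • M := by
  have h : (A.charpoly - Polynomial.X ^ n).map (Int.castRingHom (ZMod p)) = 0 := by
    rw [Polynomial.map_sub, Polynomial.map_pow, Polynomial.map_X]
    exact sub_eq_zero.2 (t_eq_iff.1 ht)
  have hd : Polynomial.C (p : ℤ) ∣ A.charpoly - Polynomial.X ^ n := by
    rw [Polynomial.C_dvd_iff_dvd_coeff]
    intro i
    have := congrArg (fun f => Polynomial.coeff f i) h
    rw [Polynomial.coeff_map, Polynomial.coeff_zero, eq_intCast] at this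
    exact (ZMod.intCast_zmod_eq_zero_iff_dvd _ _).1 this
  obtain ⟨g, hg⟩ := hd
  refine ⟨-Polynomial.aeval A g, ?_⟩
  have := congrArg (Polynomial.aeval A) hg
  rw [map_sub, map_pow, Polynomial.aeval_X, Matrix.aeval_self_charpoly, map_mul,
    Polynomial.aeval_C, zero_sub, ← Algebra.smul_def] at this
  rw [smul_neg, ← this, neg_neg]

/-- Since `p` divides `A ^ n`, the power `A ^ (n * m)` is divisible by `p ^ m`, enough to clear the
denominators of any given vector. -/
theorem Gbar_eq_top {p : ℕ} [Fact p.Prime] {A : Matrix (Fin n) (Fin n) ℤ}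
    (hA : A.det ≠ 0) (ht : t p A = n) : Gbar p A = ⊤ := by
  refine eq_top_iff.2 fun v _ => ?_
  obtain ⟨M, hM⟩ := exists_pow_eq_smul ht
  have hm : ∃ m : ℕ, (p : ℚ_[p]) ^ m • v ∈ integralVec n p := by
    have hi : ∀ i, ∃ m : ℕ, ‖(p : ℚ_[p]) ^ m * v i‖ ≤ 1 := by
      intro i
      have hlim : Filter.Tendsto (fun m : ℕ => (p : ℚ_[p]) ^ m * v i) Filter.atTop (nhds 0) := by
        simpa using (tendsto_pow_atTop_nhds_zero_of_norm_lt_one Padic.norm_p_lt_one).mul_const (v i)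
      have := (hlim.norm.eventually (ge_mem_nhds (by simp : ‖(0 : ℚ_[p])‖ < 1))).exists
      exact this
    choose m hm using hi
    refine ⟨Finset.univ.sup m, fun i => ?_⟩
    obtain ⟨r, hr⟩ := Nat.exists_eq_add_of_le' (Finset.le_sup (Finset.mem_univ i) : m i ≤ _)
    rw [hr, Pi.smul_apply, smul_eq_mul, pow_add, mul_assoc]
    exact (PadicInt.subring p).mul_mem (pow_mem (natCast_mem _ p) r) (hm i)
  obtain ⟨m, hm⟩ := hm
  refine (mem_Gbar_iff hA).2 ⟨n * m, ?_⟩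
  have h : padicMat p A ^ (n * m) = (p : ℚ_[p]) ^ m • padicMat p (M ^ m) := by
    rw [padicMat_pow, pow_mul, hM, smul_pow]
    ext i j
    change (((p : ℤ) ^ m * (M ^ m) i j : ℤ) : ℚ_[p]) = (p : ℚ_[p]) ^ m * (((M ^ m) i j : ℤ) : ℚ_[p])
    rw [Int.cast_mul, Int.cast_pow, Int.cast_natCast]
  rw [h, Matrix.smul_mulVec, ← Matrix.mulVec_smul]
  exact padicMat_mulVec_mem _ hm

/-! ### Normal forms and their coordinates. -/

/-- The module `Span_{ℚ_p}(x_i, i < s) ⊕ Span_{ℤ_p}(e_j, j ≥ s)` attached to coefficients `a`. -/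
def normalForm (p : ℕ) [Fact p.Prime] (s : ℕ) (a : Fin n → Fin n → ℤ_[p]) :
    Submodule ℤ_[p] (Fin n → ℚ_[p]) :=
  (Submodule.span ℚ_[p] (xvec p s (Pi.basisFun ℤ (Fin n)) a '' {i | (i : ℕ) < s})).restrictScalars
      ℤ_[p] ⊔
    Submodule.span ℤ_[p] ((fun j => toPadicVec p (Pi.basisFun ℤ (Fin n) j)) '' {j | s ≤ (j : ℕ)})

/-- The coefficient of `e_k`, `k ≥ s`, in the basis formed by `x_i` (`i < s`) and `e_j`
(`j ≥ s`). -/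
def coord (p : ℕ) [Fact p.Prime] (s : ℕ) (a : Fin n → Fin n → ℤ_[p]) (k : Fin n) :
    (Fin n → ℚ_[p]) →ₗ[ℚ_[p]] ℚ_[p] :=
  (LinearMap.proj k : (Fin n → ℚ_[p]) →ₗ[ℚ_[p]] ℚ_[p]) -
    ∑ i ∈ (Finset.univ : Finset (Fin n)).filter (fun i : Fin n => (i : ℕ) < s),
      (a i k : ℚ_[p]) • (LinearMap.proj i : (Fin n → ℚ_[p]) →ₗ[ℚ_[p]] ℚ_[p])

theorem coord_apply {p : ℕ} [Fact p.Prime] (s : ℕ) (a : Fin n → Fin n → ℤ_[p]) (k : Fin n)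
    (v : Fin n → ℚ_[p]) : coord p s a k v =
      v k - ∑ i ∈ (Finset.univ : Finset (Fin n)).filter (fun i : Fin n => (i : ℕ) < s),
        v i * (a i k : ℚ_[p]) := by
  simp [coord, mul_comm]

theorem toPadicVec_basisFun (p : ℕ) [Fact p.Prime] (j : Fin n) :
    toPadicVec p (Pi.basisFun ℤ (Fin n) j) = Pi.single j 1 := by
  ext i
  simp [toPadicVec, Pi.single_apply]

theorem xvec_apply (p : ℕ) [Fact p.Prime] (s : ℕ) (a : Fin n → Fin n → ℤ_[p]) (i l : Fin n) :
    xvec p s (Pi.basisFun ℤ (Fin n)) a i l =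
      (if l = i then 1 else 0) + if s ≤ (l : ℕ) then (a i l : ℚ_[p]) else 0 := by
  simp only [xvec, toPadicVec_basisFun, Pi.add_apply, Finset.sum_apply, Pi.smul_apply,
    Pi.single_apply, smul_eq_mul, mul_ite, mul_one, mul_zero, Finset.sum_ite_eq, Finset.mem_filter,
    Finset.mem_univ, true_and]

theorem coord_xvec {p : ℕ} [Fact p.Prime] {s : ℕ} (a : Fin n → Fin n → ℤ_[p]) {i k : Fin n}
    (hi : (i : ℕ) < s) (hk : s ≤ (k : ℕ)) :
    coord p s a k (xvec p s (Pi.basisFun ℤ (Fin n)) a i) = 0 := by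
  have hki : k ≠ i := by
    rintro rfl
    omega
  have : ∀ l ∈ (Finset.univ : Finset (Fin n)).filter (fun l : Fin n => (l : ℕ) < s),
      xvec p s (Pi.basisFun ℤ (Fin n)) a i l * (a l k : ℚ_[p]) =
        if l = i then (a i k : ℚ_[p]) else 0 := by
    intro l hl
    rw [xvec_apply, if_neg (not_le.2 (Finset.mem_filter.1 hl).2), add_zero, ite_mul, one_mul,
      zero_mul]
    split_ifs with h
    · rw [h]
    · rfl
  rw [coord_apply, Finset.sum_congr rfl this, xvec_apply, if_neg hki, if_pos hk,
    Finset.sum_ite_eq', if_pos (by simpa using hi), zero_add, sub_self]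

theorem coord_single {p : ℕ} [Fact p.Prime] {s : ℕ} (a : Fin n → Fin n → ℤ_[p]) {j : Fin n}
    (k : Fin n) (hj : s ≤ (j : ℕ)) :
    coord p s a k (Pi.single j 1) = if k = j then 1 else 0 := by
  rw [coord_apply, Finset.sum_eq_zero, sub_zero, Pi.single_apply]
  intro i hi
  have hij : i ≠ j := by
    rintro rfl
    exact absurd (Finset.mem_filter.1 hi).2 (not_lt.2 hj)
  rw [Pi.single_eq_of_ne hij, zero_mul]

/-- The coefficient of `x_i` is just `v i`, because the correction terms of the `x_i` live in the
positions `≥ s`; `coord` is what remains there once these terms are subtracted. -/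
theorem eq_sum_xvec_add_sum_coord {p : ℕ} [Fact p.Prime] (s : ℕ) (a : Fin n → Fin n → ℤ_[p])
    (v : Fin n → ℚ_[p]) :
    v = ∑ i ∈ (Finset.univ : Finset (Fin n)).filter (fun i : Fin n => (i : ℕ) < s),
          v i • xvec p s (Pi.basisFun ℤ (Fin n)) a i +
        ∑ j ∈ (Finset.univ : Finset (Fin n)).filter (fun j : Fin n => s ≤ (j : ℕ)),
          coord p s a j v • (Pi.single j 1 : Fin n → ℚ_[p]) := by
  ext l
  simp only [Pi.add_apply, Finset.sum_apply, Pi.smul_apply, smul_eq_mul, xvec_apply,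
    Pi.single_apply, mul_add, mul_ite, mul_one, mul_zero, Finset.sum_add_distrib,
    Finset.sum_ite_eq, Finset.mem_filter, Finset.mem_univ, true_and]
  by_cases hl : s ≤ (l : ℕ)
  · simp [hl, coord_apply]
  · simp [hl, not_le.1 hl]

theorem mem_span_xvec_iff {p : ℕ} [Fact p.Prime] {s : ℕ} {a : Fin n → Fin n → ℤ_[p]}
    {v : Fin n → ℚ_[p]} :
    v ∈ Submodule.span ℚ_[p] (xvec p s (Pi.basisFun ℤ (Fin n)) a '' {i | (i : ℕ) < s}) ↔
      ∀ k : Fin n, s ≤ (k : ℕ) → coord p s a k v = 0 := by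
  constructor
  · intro hv k hk
    have : Submodule.span ℚ_[p] (xvec p s (Pi.basisFun ℤ (Fin n)) a '' {i | (i : ℕ) < s}) ≤
        LinearMap.ker (coord p s a k) := by
      rw [Submodule.span_le]
      rintro _ ⟨i, hi, rfl⟩
      exact coord_xvec a hi hk
    exact this hv
  · intro h
    rw [eq_sum_xvec_add_sum_coord s a v]
    refine Submodule.add_mem _ (Submodule.sum_mem _ fun i hi => Submodule.smul_mem _ _
      (Submodule.subset_span ⟨i, (Finset.mem_filter.1 hi).2, rfl⟩)) ?_
    rw [Finset.sum_eq_zero]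
    · exact Submodule.zero_mem _
    · intro j hj
      rw [h j (Finset.mem_filter.1 hj).2, zero_smul]

theorem mem_normalForm_iff {p : ℕ} [Fact p.Prime] {s : ℕ} {a : Fin n → Fin n → ℤ_[p]}
    {v : Fin n → ℚ_[p]} :
    v ∈ normalForm p s a ↔
      ∀ k : Fin n, s ≤ (k : ℕ) → coord p s a k v ∈ PadicInt.subring p := by
  constructor
  · intro hv k hk
    obtain ⟨x, hx, y, hy, rfl⟩ := Submodule.mem_sup.1 hv
    rw [map_add, mem_span_xvec_iff.1 hx k hk, zero_add]
    induction hy using Submodule.span_induction with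
    | mem y hy =>
      obtain ⟨j, hj, rfl⟩ := hy
      dsimp only
      rw [toPadicVec_basisFun, coord_single a k hj]
      split_ifs
      · exact (PadicInt.subring p).one_mem
      · exact (PadicInt.subring p).zero_mem
    | zero => simp
    | add y z _ _ hy hz =>
      rw [map_add]
      exact (PadicInt.subring p).add_mem
        (hy (Submodule.add_mem_sup hx ‹_›)) (hz (Submodule.add_mem_sup hx ‹_›))
    | smul c y _ hy =>
      rw [← algebraMap_smul ℚ_[p] c y, map_smul]
      exact (PadicInt.subring p).mul_mem c.2 (hy (Submodule.add_mem_sup hx ‹_›))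
  · intro h
    rw [eq_sum_xvec_add_sum_coord s a v]
    refine Submodule.add_mem_sup ?_ ?_
    · rw [Submodule.restrictScalars_mem]
      exact Submodule.sum_mem _ fun i hi => Submodule.smul_mem _ _
        (Submodule.subset_span ⟨i, (Finset.mem_filter.1 hi).2, rfl⟩)
    · refine Submodule.sum_mem _ fun j hj => ?_
      have hj' := (Finset.mem_filter.1 hj).2
      let c : ℤ_[p] := ⟨coord p s a j v, h j hj'⟩
      have : coord p s a j v • (Pi.single j 1 : Fin n → ℚ_[p]) =
          c • (Pi.single j 1 : Fin n → ℚ_[p]) := (algebraMap_smul ℚ_[p] c _)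
      rw [this]
      exact Submodule.smul_mem _ _ (Submodule.subset_span ⟨j, hj', toPadicVec_basisFun p j⟩)

/-- The first `s` coordinates of the `x_i` are those of unit vectors. The dimension makes `s` an
invariant of the module. -/
theorem finrank_span_xvec {p : ℕ} [Fact p.Prime] {s : ℕ} (hs : s ≤ n)
    (a : Fin n → Fin n → ℤ_[p]) :
    Module.finrank ℚ_[p]
      (Submodule.span ℚ_[p] (xvec p s (Pi.basisFun ℤ (Fin n)) a '' {i | (i : ℕ) < s})) = s := by
  have himg : xvec p s (Pi.basisFun ℤ (Fin n)) a '' {i | (i : ℕ) < s} =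
      Set.range fun i : Fin s => xvec p s (Pi.basisFun ℤ (Fin n)) a (Fin.castLE hs i) := by
    ext v
    constructor
    · rintro ⟨i, hi, rfl⟩
      exact ⟨⟨i, hi⟩, rfl⟩
    · rintro ⟨i, rfl⟩
      exact ⟨_, i.2, rfl⟩
  have hli : LinearIndependent ℚ_[p]
      fun i : Fin s => xvec p s (Pi.basisFun ℤ (Fin n)) a (Fin.castLE hs i) := by
    rw [Fintype.linearIndependent_iff]
    intro g hg l
    have h := congrFun hg (Fin.castLE hs l)
    have hl : ¬ s ≤ (l : ℕ) := not_le.2 l.2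
    simpa [xvec_apply, Finset.sum_apply, hl, (Fin.castLE_injective hs).eq_iff] using h
  rw [himg, finrank_span_eq_card hli, Fintype.card_fin]

/-- A nonzero coordinate can be rescaled out of `ℤ_p`, so a full `ℚ_p`-line stays inside a normal
form only if its coordinates `k ≥ s` vanish. -/
theorem mem_D_iff_of_normalForm {p : ℕ} [Fact p.Prime] {A : Matrix (Fin n) (Fin n) ℤ} {s : ℕ}
    {a : Fin n → Fin n → ℤ_[p]} (h : Gbar p A = normalForm p s a) {v : Fin n → ℚ_[p]} :
    v ∈ D p A ↔
      v ∈ Submodule.span ℚ_[p] (xvec p s (Pi.basisFun ℤ (Fin n)) a '' {i | (i : ℕ) < s}) := by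
  rw [mem_D_iff, mem_span_xvec_iff, h]
  simp only [mem_normalForm_iff, map_smul, smul_eq_mul]
  constructor
  · intro hv k hk
    by_contra h0
    -- This scalar turns the nonzero coordinate into `p⁻¹`, which is not integral.
    have h1 := hv ((p : ℚ_[p])⁻¹ * (coord p s a k v)⁻¹) k hk
    rw [mul_assoc, inv_mul_cancel₀ h0, mul_one, PadicInt.mem_subring_iff, norm_inv] at h1
    exact absurd h1 (not_le.2 (one_lt_inv_iff₀.2
      ⟨norm_pos_iff.2 (Nat.cast_ne_zero.2 (Fact.out : p.Prime).ne_zero), Padic.norm_p_lt_one⟩))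
  · intro hv c k hk
    rw [hv k hk, mul_zero]
    exact (PadicInt.subring p).zero_mem

/-! ### The criterion at a single prime. -/

/-- The integrality of the coordinates `k ≥ s` of the columns `j ≥ s` of `M`. -/
def LocalCondition (p : ℕ) [Fact p.Prime] (s : ℕ) (b : Fin n → Fin n → ℤ_[p])
    (M : Matrix (Fin n) (Fin n) ℚ_[p]) : Prop :=
  ∀ k j : Fin n, s ≤ (k : ℕ) → s ≤ (j : ℕ) → coord p s b k (M.col j) ∈ PadicInt.subring p

theorem condition_iff {p : ℕ} [Fact p.Prime] {B : Matrix (Fin n) (Fin n) ℤ}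
    {b : Fin n → Fin n → ℤ_[p]} {T : Matrix (Fin n) (Fin n) ℚ} :
    Condition B p b T ↔ LocalCondition p (t p B) b (T.map (Rat.cast : ℚ → ℚ_[p])) := by
  simp only [Condition, LocalCondition, coord_apply]
  rfl

theorem mulVec_mem_of_localCondition {p : ℕ} [Fact p.Prime] {A B : Matrix (Fin n) (Fin n) ℤ}
    {s : ℕ} {a b : Fin n → Fin n → ℤ_[p]} (hA : Gbar p A = normalForm p s a)
    (hB : Gbar p B = normalForm p s b) {M : Matrix (Fin n) (Fin n) ℚ_[p]}
    (hD : ∀ v ∈ D p A, M.mulVec v ∈ D p B) (hM : LocalCondition p s b M) {v : Fin n → ℚ_[p]}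
    (hv : v ∈ Gbar p A) : M.mulVec v ∈ Gbar p B := by
  rw [hA] at hv
  obtain ⟨x, hx, y, hy, rfl⟩ := Submodule.mem_sup.1 hv
  rw [Matrix.mulVec_add]
  refine Submodule.add_mem _ ?_ ?_
  · simpa using mem_D_iff.1 (hD x ((mem_D_iff_of_normalForm hA).2 hx)) 1
  · have hle : Submodule.span ℤ_[p]
        ((fun j => toPadicVec p (Pi.basisFun ℤ (Fin n) j)) '' {j | s ≤ (j : ℕ)}) ≤
        (Gbar p B).comap (M.mulVecLin.restrictScalars ℤ_[p]) := by
      rw [Submodule.span_le]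
      rintro _ ⟨j, hj, rfl⟩
      change M.mulVec (toPadicVec p (Pi.basisFun ℤ (Fin n) j)) ∈ Gbar p B
      rw [toPadicVec_basisFun, Matrix.mulVec_single_one, hB]
      exact mem_normalForm_iff.2 fun k hk => hM k j hk hj
    exact hle hy

theorem image_mulVec_eq_iff {p : ℕ} [Fact p.Prime] {M N : Matrix (Fin n) (Fin n) ℚ_[p]}
    (hMN : M * N = 1) (hNM : N * M = 1) {S U : Set (Fin n → ℚ_[p])} :
    (fun v => M.mulVec v) '' S = U ↔
      (∀ v ∈ S, M.mulVec v ∈ U) ∧ ∀ v ∈ U, N.mulVec v ∈ S := by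
  constructor
  · rintro rfl
    refine ⟨fun v hv => ⟨v, hv, rfl⟩, ?_⟩
    rintro _ ⟨v, hv, rfl⟩
    dsimp only
    rwa [Matrix.mulVec_mulVec, hNM, Matrix.one_mulVec]
  · rintro ⟨h1, h2⟩
    refine Set.Subset.antisymm (Set.image_subset_iff.2 h1) fun v hv => ⟨_, h2 v hv, ?_⟩
    dsimp only
    rw [Matrix.mulVec_mulVec, hMN, Matrix.one_mulVec]

/-- An isomorphism of the modules carries divisible part to divisible part, and comparing dimensions
gives `s = r`. The local conditions then say where `M` and `N` send the generators `e_j`;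
conversely, control of the divisible part and of these generators yields both inclusions. -/
theorem image_Gbar_eq_iff {p : ℕ} [Fact p.Prime] {A B : Matrix (Fin n) (Fin n) ℤ}
    {s r : ℕ} (hs : s ≤ n) (hr : r ≤ n) {a b : Fin n → Fin n → ℤ_[p]}
    (hA : Gbar p A = normalForm p s a) (hB : Gbar p B = normalForm p r b)
    {M N : Matrix (Fin n) (Fin n) ℚ_[p]} (hMN : M * N = 1) (hNM : N * M = 1) :
    (fun v => M.mulVec v) '' (Gbar p A : Set (Fin n → ℚ_[p])) = Gbar p B ↔
      s = r ∧ (fun v => M.mulVec v) '' (D p A : Set (Fin n → ℚ_[p])) = D p B ∧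
        LocalCondition p r b M ∧ LocalCondition p s a N := by
  rw [image_mulVec_eq_iff hMN hNM, image_mulVec_eq_iff hMN hNM]
  simp only [SetLike.mem_coe]
  constructor
  · rintro ⟨h1, h2⟩
    have hD1 : ∀ v ∈ D p A, M.mulVec v ∈ D p B := fun v hv => mem_D_iff.2 fun c => by
      rw [← Matrix.mulVec_smul]
      exact h1 _ (mem_D_iff.1 hv c)
    have hD2 : ∀ v ∈ D p B, N.mulVec v ∈ D p A := fun v hv => mem_D_iff.2 fun c => by
      rw [← Matrix.mulVec_smul]
      exact h2 _ (mem_D_iff.1 hv c)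
    have hsingle : ∀ {C : Matrix (Fin n) (Fin n) ℤ} {q : ℕ} {d : Fin n → Fin n → ℤ_[p]}
        (_ : Gbar p C = normalForm p q d) (j : Fin n), q ≤ (j : ℕ) →
        (Pi.single j 1 : Fin n → ℚ_[p]) ∈ Gbar p C := by
      intro C q d hC j hj
      rw [hC, mem_normalForm_iff]
      intro k _
      rw [coord_single d k hj]
      split_ifs
      · exact (PadicInt.subring p).one_mem
      · exact (PadicInt.subring p).zero_mem
    have hinj : Function.Injective M.mulVecLin :=
      Matrix.mulVec_injective_of_isUnit ⟨⟨M, N, hMN, hNM⟩, rfl⟩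
    have hmap : (Submodule.span ℚ_[p]
          (xvec p s (Pi.basisFun ℤ (Fin n)) a '' {i | (i : ℕ) < s})).map M.mulVecLin =
        Submodule.span ℚ_[p] (xvec p r (Pi.basisFun ℤ (Fin n)) b '' {i | (i : ℕ) < r}) := by
      apply SetLike.coe_injective
      rw [Submodule.map_coe]
      refine (image_mulVec_eq_iff hMN hNM).2 ⟨fun v hv => ?_, fun v hv => ?_⟩
      · exact (mem_D_iff_of_normalForm hB).1 (hD1 v ((mem_D_iff_of_normalForm hA).2 hv))
      · exact (mem_D_iff_of_normalForm hA).1 (hD2 v ((mem_D_iff_of_normalForm hB).2 hv))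
    have hsr : s = r := by
      rw [← finrank_span_xvec hs a, ← finrank_span_xvec hr b, ← hmap]
      exact (Submodule.equivMapOfInjective _ hinj _).finrank_eq
    refine ⟨hsr, ⟨hD1, hD2⟩, fun k j hk hj => ?_, fun k j hk hj => ?_⟩
    · rw [← Matrix.mulVec_single_one]
      exact mem_normalForm_iff.1 (hB ▸ h1 _ (hsingle hA j (hsr ▸ hj))) k hk
    · rw [← Matrix.mulVec_single_one]
      exact mem_normalForm_iff.1 (hA ▸ h2 _ (hsingle hB j (hsr ▸ hj))) k hk
  · rintro ⟨rfl, ⟨hD1, hD2⟩, hM, hN⟩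
    exact ⟨fun v hv => mulVec_mem_of_localCondition hA hB hD1 hM hv,
      fun v hv => mulVec_mem_of_localCondition hB hA hD2 hN hv⟩

/-! ### All primes together. -/

/-- The characteristic prescribes this only on `𝒫'`. At the extreme values of `t p A` the
coefficients play no role: for `0` there is no `x_i`, and for `n` there is no coordinate to test. -/
theorem Gbar_eq_normalForm {A : Matrix (Fin n) (Fin n) ℤ} (hA : A.det ≠ 0)
    {α : (p : ℕ) → [Fact p.Prime] → Fin n → Fin n → ℤ_[p]}
    (hα : IsCharacteristic A (Pi.basisFun ℤ (Fin n)) α) (p : ℕ) [Fact p.Prime] :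
    Gbar p A = normalForm p (t p A) (α p) := by
  by_cases h0 : t p A = 0
  · ext v
    rw [Gbar_eq_integralVec hA h0, mem_normalForm_iff, mem_integralVec, h0]
    simp [coord_apply]
  by_cases hn : t p A = n
  · ext v
    rw [Gbar_eq_top hA hn, mem_normalForm_iff]
    refine iff_of_true trivial fun k hk => ?_
    have := k.2
    omega
  · exact hα p (mem_primeDivisors'_iff.2 ⟨h0, hn⟩)

theorem D_eq_bot {A : Matrix (Fin n) (Fin n) ℤ} {p : ℕ} [Fact p.Prime]
    {a : Fin n → Fin n → ℤ_[p]} (h : Gbar p A = normalForm p 0 a) : D p A = ⊥ := by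
  ext v
  rw [mem_D_iff_of_normalForm h]
  simp

theorem D_eq_top {A : Matrix (Fin n) (Fin n) ℤ} {p : ℕ} [Fact p.Prime] (h : Gbar p A = ⊤) :
    D p A = ⊤ := by
  ext v
  rw [mem_D_iff, h]
  simp

theorem mem_range_map_iff (S : Subalgebra ℤ ℚ) (T : Matrix.GeneralLinearGroup (Fin n) ℚ) :
    T ∈ (Matrix.GeneralLinearGroup.map (n := Fin n) (algebraMap S ℚ)).range ↔
      ∀ i j, (T : Matrix (Fin n) (Fin n) ℚ) i j ∈ S ∧
        ((T⁻¹ : Matrix.GeneralLinearGroup (Fin n) ℚ) : Matrix (Fin n) (Fin n) ℚ) i j ∈ S := by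
  constructor
  · rintro ⟨U, rfl⟩ i j
    refine ⟨(U i j).2, ?_⟩
    rw [← map_inv]
    exact (U⁻¹ i j).2
  · intro h
    let X : Matrix (Fin n) (Fin n) S := Matrix.of fun i j => ⟨_, (h i j).1⟩
    let Y : Matrix (Fin n) (Fin n) S := Matrix.of fun i j => ⟨_, (h i j).2⟩
    have hinj : Function.Injective ((algebraMap S ℚ).mapMatrix (m := Fin n)) :=
      Matrix.map_injective Subtype.val_injective
    have hX : (algebraMap S ℚ).mapMatrix X = (T : Matrix (Fin n) (Fin n) ℚ) := rfl
    have hY : (algebraMap S ℚ).mapMatrix Y =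
      ((T⁻¹ : Matrix.GeneralLinearGroup (Fin n) ℚ) : Matrix (Fin n) (Fin n) ℚ) := rfl
    have hXY : X * Y = 1 := hinj (by rw [map_mul, hX, hY, map_one, Units.mul_inv])
    have hYX : Y * X = 1 := hinj (by rw [map_mul, hX, hY, map_one, Units.inv_mul])
    exact ⟨⟨X, Y, hXY, hYX⟩, Units.ext hX⟩

theorem rat_map_mul_eq_one (p : ℕ) [Fact p.Prime] {M N : Matrix (Fin n) (Fin n) ℚ}
    (h : M * N = 1) : M.map (Rat.cast : ℚ → ℚ_[p]) * N.map (Rat.cast : ℚ → ℚ_[p]) = 1 := by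
  have := congrArg (Rat.castHom ℚ_[p]).mapMatrix h
  rwa [map_mul, map_one] at this

theorem condition_iff_of_t_eq_zero {B : Matrix (Fin n) (Fin n) ℤ} {p : ℕ} [Fact p.Prime]
    {b : Fin n → Fin n → ℤ_[p]} (ht : t p B = 0) {T : Matrix (Fin n) (Fin n) ℚ} :
    Condition B p b T ↔ ∀ k j, (T k j : ℚ_[p]) ∈ PadicInt.subring p := by
  simp [Condition, ht]

end Solenoid

end

open Solenoid

theorem theorem3p8 (n : ℕ) (A B : Matrix (Fin n) (Fin n) ℤ) (hA : A.det ≠ 0) (hB : B.det ≠ 0)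
    (α β : (p : ℕ) → [Fact p.Prime] → Fin n → Fin n → ℤ_[p])
    (hα : Solenoid.IsCharacteristic A (Pi.basisFun ℤ (Fin n)) α)
    (hβ : Solenoid.IsCharacteristic B (Pi.basisFun ℤ (Fin n)) β)
    (T : Matrix.GeneralLinearGroup (Fin n) ℚ) :
    (fun v => (T : Matrix (Fin n) (Fin n) ℚ).mulVec v) '' Solenoid.G A = Solenoid.G B ↔
      Solenoid.primeDivisors A = Solenoid.primeDivisors B ∧
      Solenoid.primeDivisors' A = Solenoid.primeDivisors' B ∧
      Solenoid.R A = Solenoid.R B ∧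
      (∀ p ∈ Solenoid.primeDivisors A, Solenoid.t p A = Solenoid.t p B) ∧
      T ∈ (Matrix.GeneralLinearGroup.map (n := Fin n) (algebraMap (Solenoid.R A) ℚ)).range ∧
      ∀ (p : ℕ) [Fact p.Prime], p ∈ Solenoid.primeDivisors' A →
        (fun v => ((T : Matrix (Fin n) (Fin n) ℚ).map (Rat.cast : ℚ → ℚ_[p])).mulVec v) ''
            (Solenoid.D p A : Set (Fin n → ℚ_[p])) = (Solenoid.D p B : Set (Fin n → ℚ_[p])) ∧
        Solenoid.Condition B p (β p) (T : Matrix (Fin n) (Fin n) ℚ) ∧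
        Solenoid.Condition A p (α p) ((T⁻¹ : Matrix.GeneralLinearGroup (Fin n) ℚ) :
          Matrix (Fin n) (Fin n) ℚ) := by
  -- A uniform criterion over all primes, not only those in `𝒫'`; what remains is to sort the primes
  -- by the value of `t p A`.
  have hlocal : (fun v => (T : Matrix (Fin n) (Fin n) ℚ).mulVec v) '' G A = G B ↔
      ∀ (p : ℕ) [Fact p.Prime], t p A = t p B ∧
        (fun v => ((T : Matrix (Fin n) (Fin n) ℚ).map (Rat.cast : ℚ → ℚ_[p])).mulVec v) ''
            (D p A : Set (Fin n → ℚ_[p])) = (D p B : Set (Fin n → ℚ_[p])) ∧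
        Condition B p (β p) (T : Matrix (Fin n) (Fin n) ℚ) ∧
        Condition A p (α p) ((T⁻¹ : Matrix.GeneralLinearGroup (Fin n) ℚ) :
          Matrix (Fin n) (Fin n) ℚ) := by
    rw [image_G_eq_iff hA hB T.mul_inv T.inv_mul]
    refine forall_congr' fun p => forall_congr' fun _ => ?_
    rw [image_Gbar_eq_iff (t_le p A) (t_le p B) (Gbar_eq_normalForm hA hα p)
      (Gbar_eq_normalForm hB hβ p) (rat_map_mul_eq_one p T.mul_inv) (rat_map_mul_eq_one p T.inv_mul),
      condition_iff, condition_iff]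
  rw [hlocal]
  constructor
  · intro h
    have hP : primeDivisors A = primeDivisors B := by
      ext p
      by_cases hp : p.Prime
      · have := Fact.mk hp
        rw [mem_primeDivisors_iff, mem_primeDivisors_iff, (h p).1]
      · exact iff_of_false (fun h => hp h.1) (fun h => hp h.1)
    have hP' : primeDivisors' A = primeDivisors' B := by
      ext p
      by_cases hp : p.Prime
      · have := Fact.mk hp
        rw [mem_primeDivisors'_iff, mem_primeDivisors'_iff, (h p).1]
      · exact iff_of_false (fun h => hp h.1.1) (fun h => hp h.1.1)
    have hR : R A = R B := by
      ext q
      rw [mem_R_iff hA, mem_R_iff hB]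
      refine forall_congr' fun p => forall_congr' fun _ => ?_
      rw [← t_eq_zero_iff, ← t_eq_zero_iff, (h p).1]
    refine ⟨hP, hP', hR, fun p hp => ?_, ?_, fun p _ _ => (h p).2⟩
    · have := Fact.mk hp.1
      exact (h p).1
    -- At primes not dividing the determinants, the two conditions are the `p`-integrality of the
    -- entries of `T` and `T⁻¹`.
    · refine (mem_range_map_iff _ T).2 fun i j => ⟨?_, ?_⟩
      · rw [hR]
        exact (mem_R_iff hB).2 fun p _ hp =>
          (condition_iff_of_t_eq_zero (t_eq_zero_iff.2 hp)).1 (h p).2.2.1 i j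
      · exact (mem_R_iff hA).2 fun p _ hp =>
          (condition_iff_of_t_eq_zero (t_eq_zero_iff.2 hp)).1 (h p).2.2.2 i j
  · rintro ⟨hP, -, -, ht, hT, h⟩ p hp
    have htp : t p A = t p B := by
      by_cases hpA : p ∈ primeDivisors A
      · exact ht p hpA
      · have hpB : p ∉ primeDivisors B := hP ▸ hpA
        rw [mem_primeDivisors_iff, not_not] at hpA hpB
        rw [hpA, hpB]
    refine ⟨htp, ?_⟩
    rw [mem_range_map_iff] at hT
    by_cases h0 : t p A = 0
    · have h0B := htp.symm.trans h0
      refine ⟨?_, (condition_iff_of_t_eq_zero h0B).2 fun i j => ?_,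
        (condition_iff_of_t_eq_zero h0).2 fun i j => ?_⟩
      · rw [D_eq_bot (a := α p) (h0 ▸ Gbar_eq_normalForm hA hα p),
          D_eq_bot (a := β p) (h0B ▸ Gbar_eq_normalForm hB hβ p)]
        simp
      · exact (mem_R_iff hA).1 (hT i j).1 p (t_eq_zero_iff.1 h0)
      · exact (mem_R_iff hA).1 (hT i j).2 p (t_eq_zero_iff.1 h0)
    -- Such a prime lies outside `𝒫'`: both divisible parts are `ℚ_p^n`, and no index `k` satisfies
    -- `t_p < k ≤ n`.
    by_cases hn : t p A = n
    · have hnB := htp.symm.trans hn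
      refine ⟨?_, fun k _ hk => absurd k.2 (by omega), fun k _ hk => absurd k.2 (by omega)⟩
      rw [D_eq_top (Gbar_eq_top hA hn), D_eq_top (Gbar_eq_top hB hnB)]
      exact (image_mulVec_eq_iff (rat_map_mul_eq_one p T.mul_inv)
        (rat_map_mul_eq_one p T.inv_mul)).2 ⟨fun _ _ => trivial, fun _ _ => trivial⟩
    · exact h p (mem_primeDivisors'_iff.2 ⟨h0, hn⟩)
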